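/- Let $X=\{0,1\}$. The Basilica group $B$ is the group of permutations of the set $X^\omega$ of infinite binary words generated by the two permutations $a,b$ defined recursively by $$a(0w)=0\,b(w),\qquad a(1w)=1w,\qquad b(0w)=1\,a(w),\qquad b(1w)=0w\qquad (w\in X^\omega).$$ For $\xi\in X^\omega$ let $\Gamma_\xi$ be the orbital Schreier graph of $\xi$: its vertex set is the orbit $B\cdot\xi$, and two vertices $\eta,\eta'$ are joined by an edge if $s(\eta)=\eta'$ for some $s\in\{a,a^{-1},b,b^{-1}\}$. A ray in a graph is an infinite sequence of distinct vertices in which consecutive vertices are adjacent; two rays are equivalent if, for every finite set $K$ of vertices, both have a tail in the same connected component of the graph with $K$ removed; an end is an equivalence class of rays. For $i\in\{1,2,4\}$ let $E_i$ be the set of all $\xi\in X^\omega$ such that $\Gamma_\xi$ has exactly $i$ ends. Then: 1. $E_4=\{w0^\omega,\ w(01)^\omega \mid w\in X^*\}$, where $X^*$ is the set of finite words over $X$ (including the empty word), $0^\omega=000\ldots$ and $(01)^\omega=010101\ldots$; 2. $E_1$ is the set of all words $\alpha_1\beta_1\alpha_2\beta_2\ldots$ with $\alpha_i,\beta_j\in\{0,1\}$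 such that both sequences $\{\alpha_i\}_{i\ge1}$ and $\{\beta_j\}_{j\ge1}$ contain infinitely many $1$'s; 3. $E_2=X^\omega\setminus(E_1\sqcup E_4)$. -/

import Mathlib

namespace Basilica

/-! ### Invertible automata and their action on right-infinite words -/

/-- The right-infinite words `x₁x₂x₃…` over the alphabet `X`; the letter `xₙ₊₁` is the value at
`n`. -/
abbrev InfWord (X : Type*) : Type _ := ℕ → X

/-- An invertible automaton with states `S` over the alphabet `X`: a transition map `S × X → S`
and an output map `S × X → X` which is a permutation of `X` for every state. -/
structure InvAutomaton (S X : Type*) where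
  transition : S → X → S
  output : S → Equiv.Perm X

namespace InvAutomaton

variable {S X : Type*} (A : InvAutomaton S X)

/-- The state in which the automaton, started in `s`, is after reading the first `n` letters
of `x`. -/
def stateAt (s : S) (x : InfWord X) : ℕ → S
  | 0 => s
  | n + 1 => A.transition (stateAt s x n) (x n)

/-- The infinite word written by the automaton started in `s` while it reads `x`. -/
def run (s : S) (x : InfWord X) : InfWord X := fun n => A.output (A.stateAt s x n) (x n)

/-- The automaton with input and output exchanged. -/
def inverse : InvAutomaton S X where
  transition s y := A.transition s ((A.output s).symm y)
  output s := (A.output s).symm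

theorem stateAt_inverse_run (s : S) (x : InfWord X) (n : ℕ) :
    A.inverse.stateAt s (A.run s x) n = A.stateAt s x n := by
  induction n with
  | zero => rfl
  | succ n ih =>
    change A.transition (A.inverse.stateAt s (A.run s x) n)
      ((A.output (A.inverse.stateAt s (A.run s x) n)).symm (A.run s x n)) = _
    rw [ih]
    simp [stateAt, run]

theorem inverse_run_run (s : S) (x : InfWord X) : A.inverse.run s (A.run s x) = x := by
  funext n
  change A.inverse.output (A.inverse.stateAt s (A.run s x) n) (A.run s x n) = x n
  rw [stateAt_inverse_run]
  simp [inverse, run]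

theorem inverse_inverse : A.inverse.inverse = A := by
  cases A
  simp [inverse]

/-- The permutation of the set of infinite words defined by the automaton started in `s`. -/
def perm (s : S) : Equiv.Perm (InfWord X) where
  toFun := A.run s
  invFun := A.inverse.run s
  left_inv := A.inverse_run_run s
  right_inv x := by
    have h := A.inverse.inverse_run_run s x
    rwa [inverse_inverse] at h

end InvAutomaton

/-! ### The Basilica group -/

/-- The states of the automaton generating the Basilica group. -/
inductive State
  | a
  | b
  | e

/-- The three-state automaton of the Basilica group over `{0, 1}`: the state `a` copies the letter
it reads, the state `b` changes it, `a` moves to `b` and `b` moves to `a` on reading `0`, both move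
to the trivial state `e` on reading `1`. So `a(0w) = 0b(w)`, `a(1w) = 1w`, `b(0w) = 1a(w)`,
`b(1w) = 0w`. -/
def automaton : InvAutomaton State (Fin 2) where
  transition
    | .a, 0 => .b
    | .a, 1 => .e
    | .b, 0 => .a
    | .b, 1 => .e
    | .e, _ => .e
  output
    | .a => 1
    | .b => Equiv.swap 0 1
    | .e => 1

/-- The Basilica group `B`, realised through its (faithful) action on the boundary `{0,1}^ω` of the
rooted binary tree: the group generated by the transformations of the automaton, that is, by `a`
and `b`, since the remaining state acts trivially. -/
def basilicaGroup : Subgroup (Equiv.Perm (InfWord (Fin 2))) :=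
  Subgroup.closure {automaton.perm .a, automaton.perm .b}

/-- The generator `a` of the Basilica group. -/
def genA : basilicaGroup := ⟨automaton.perm .a, Subgroup.subset_closure (by simp)⟩

/-- The generator `b` of the Basilica group. -/
def genB : basilicaGroup := ⟨automaton.perm .b, Subgroup.subset_closure (by simp)⟩

/-! ### Schreier graphs -/

/-- The Schreier graph of an action of `G` on `M` with respect to the generators `S` and their
inverses, without labels, loops and multiplicities of edges (which do not matter for rays and
ends): distinct points `m`, `m'` are adjacent if `s • m = m'` or `s • m' = m` for some `s ∈ S`. -/
def schreierGraph {G : Type*} (M : Type*) [Group G] [MulAction G M] (S : Set G) : SimpleGraph M :=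
  SimpleGraph.fromRel fun m m' => ∃ s ∈ S, s • m = m'

/-- The orbital Schreier graph `Γ_ξ` of the Basilica group, whose vertices are the points of the
orbit of `ξ`. -/
def orbitalGraph (ξ : InfWord (Fin 2)) : SimpleGraph (MulAction.orbit basilicaGroup ξ) :=
  schreierGraph (MulAction.orbit basilicaGroup ξ) {genA, genB}

/-! ### Ends of a graph -/

section Ends

variable {V : Type*}

/-- A ray in a graph: an infinite sequence of distinct vertices, any two consecutive ones of which
are adjacent. -/
structure Ray (G : SimpleGraph V) where
  vertex : ℕ → V
  injective : Function.Injective vertex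
  adj : ∀ n, G.Adj (vertex n) (vertex (n + 1))

/-- Two rays are equivalent if for every finite set `K` of vertices both have a tail in the same
connected component of `G \ K`. -/
def Ray.Equivalent {G : SimpleGraph V} (R R' : Ray G) : Prop :=
  ∀ K : Set V, K.Finite → ∃ C : G.ComponentCompl K, ∃ N : ℕ, ∀ n ≥ N,
    R.vertex n ∈ C ∧ R'.vertex n ∈ C

theorem Ray.Equivalent.refl {G : SimpleGraph V} (R : Ray G) : R.Equivalent R := by
  intro K hK
  have hfin : {n | R.vertex n ∈ K}.Finite := hK.preimage R.injective.injOn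
  obtain ⟨N, hN⟩ := hfin.bddAbove
  have hout : ∀ n ≥ N + 1, R.vertex n ∉ K := by
    intro n hn h
    have : n ≤ N := hN h
    omega
  refine ⟨G.componentComplMk (hout (N + 1) le_rfl), N + 1, fun n hn => ?_⟩
  rw [and_self]
  induction n, hn using Nat.le_induction with
  | base => exact G.componentComplMk_mem _
  | succ n hn ih =>
    exact SimpleGraph.ComponentCompl.mem_of_adj _ _ ih (hout _ (by omega)) (R.adj n)

theorem Ray.Equivalent.symm {G : SimpleGraph V} {R R' : Ray G} (h : R.Equivalent R') :
    R'.Equivalent R := by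
  intro K hK
  obtain ⟨C, N, hC⟩ := h K hK
  exact ⟨C, N, fun n hn => (hC n hn).symm⟩

theorem Ray.Equivalent.trans {G : SimpleGraph V} {R R' R'' : Ray G} (h : R.Equivalent R')
    (h' : R'.Equivalent R'') : R.Equivalent R'' := by
  intro K hK
  obtain ⟨C, N, hC⟩ := h K hK
  obtain ⟨D, N', hD⟩ := h' K hK
  have hCD : C = D := by
    obtain ⟨_, e⟩ := (hC (max N N') (le_max_left _ _)).2
    obtain ⟨_, e'⟩ := (hD (max N N') (le_max_right _ _)).1
    exact e.symm.trans e'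
  subst hCD
  exact ⟨C, max N N', fun n hn => ⟨(hC n (le_of_max_le_left hn)).1,
    (hD n (le_of_max_le_right hn)).2⟩⟩

/-- Equivalence of rays. -/
def raySetoid (G : SimpleGraph V) : Setoid (Ray G) where
  r := Ray.Equivalent
  iseqv := ⟨Ray.Equivalent.refl, Ray.Equivalent.symm, Ray.Equivalent.trans⟩

/-- The ends of a graph: the equivalence classes of its rays. -/
def Ends (G : SimpleGraph V) : Type _ := Quotient (raySetoid G)

/-- The number of ends of a graph, a natural number or `⊤`. -/
noncomputable def numEnds (G : SimpleGraph V) : ℕ∞ := ENat.card (Ends G)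

end Ends

/-! ### The sets in the classification -/

/-- `E i` is the set of the words `ξ` for which `Γ_ξ` has exactly `i` ends. -/
def E (i : ℕ∞) : Set (InfWord (Fin 2)) := {ξ | numEnds (orbitalGraph ξ) = i}

/-- The infinite word `wu`, for a finite word `w` and an infinite word `u`. -/
def append {X : Type*} (w : List X) (u : InfWord X) : InfWord X :=
  fun n => (w[n]?).getD (u (n - w.length))

/-- The word `0^ω = 000…`. -/
def zeros : InfWord (Fin 2) := fun _ => 0

/-- The word `(01)^ω = 0101…`. -/
def zeroOnes : InfWord (Fin 2) := fun n => if Even n then 0 else 1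

end Basilica

/-!
The orbital Schreier graphs are tree-like arrangements of `a`-orbits and `b`-orbits, and they are
self-similar: the shift `xw ↦ w` on words contracts the edges `{0w, 1w}` (edges since `b(1w) = 0w`)
and maps the Schreier graph onto itself, because `b(0w) = 1a(w)` and `a(0w) = 0b(w)`
(`Conn.lift`). Hence the components of `Γ_ξ` outside the finite set of words with the same `n`-th
shift as `ξ` can be counted in the graph of the shifted word `t = σⁿξ`, as the components outside
the single vertex `t` (`numEnds_orbitalGraph_le`). These finite sets exhaust `Γ_ξ` as soon as its
vertices are cofinal with `ξ`, which holds except for the orbit of `0^ω` (`Conn.cofinal_or`).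

*Upper bounds.* When `t` starts with `1` it is fixed by `a`, so `t` can only be left through `b(t)`
and `b⁻¹(t)`, and there are at most two components (`numEnds_le_two`). If moreover `t` has a `1` at
an odd position, then its `b`-orbit is finite, so that `b(t)` and `b⁻¹(t)` are joined by the rest of
the cycle and there is one component (`conn_permB_of_odd_one`). For the orbit of `0^ω`, which
consists of the words ending in `0^ω` or `(01)^ω` since `a(0^ω) = (01)^ω` and `b(0^ω) = (10)^ω`, a
set of four vertices which the shift maps into itself has exactly four outgoing edges
(`numEnds_of_mem_coreTails`).

*Lower bounds.* The `b`-orbit of a word is infinite exactly when all odd positions carry `0`, and on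
such words `b` acts on the even positions as the inverse of the binary adding machine. Reading the
even positions as a 2-adic integer, with the digits before the last `1` at an odd position replaced
by `0` (and all of them, if there are infinitely many such `1`s), gives a potential on all words
which `a` preserves and which `b` changes only along infinite `b`-orbits, by `-1`
(`isPotential_potB`). Within one orbit, the sign of its difference to the value at a vertex `t` on
the line is therefore constant on the components outside `t` (`IsPotential.sign_height_eq`), and it
separates the two halves of the line. The shift transports the potential to one for `a`. A single
line gives two ends, and the two lines crossing in `0^ω` give four. If neither letter sequence is
eventually `0`, König's lemma still provides a ray (`exists_ray`).
-/

namespace Basilica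

open Relation

/-! ### The recursion for the generators -/

/-- The word without its first letter. -/
def shift (u : InfWord (Fin 2)) : InfWord (Fin 2) := fun n => u (n + 1)

/-- The word with one letter added in front. -/
def cons (x : Fin 2) (u : InfWord (Fin 2)) : InfWord (Fin 2)
  | 0 => x
  | n + 1 => u n

@[simp] theorem cons_zero (x : Fin 2) (u : InfWord (Fin 2)) : cons x u 0 = x := rfl

@[simp] theorem shift_cons (x : Fin 2) (u : InfWord (Fin 2)) : shift (cons x u) = u := rfl

theorem shift_apply (u : InfWord (Fin 2)) (n : ℕ) : shift u n = u (n + 1) := rfl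

theorem shift_iterate_apply (u : InfWord (Fin 2)) (n k : ℕ) : shift^[n] u k = u (k + n) := by
  induction n generalizing k with
  | zero => rfl
  | succ n ih =>
    rw [Function.iterate_succ_apply', shift_apply, ih]
    congr 1
    omega

theorem ext_shift {u v : InfWord (Fin 2)} (h₀ : u 0 = v 0) (h : shift u = shift v) : u = v := by
  funext n
  cases n with
  | zero => exact h₀
  | succ n => exact congrFun h n

theorem eq_zero_or_one (x : Fin 2) : x = 0 ∨ x = 1 := by omega

/-- The action of the generator `a` on words. -/
def permA : Equiv.Perm (InfWord (Fin 2)) := automaton.perm .a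

/-- The action of the generator `b` on words. -/
def permB : Equiv.Perm (InfWord (Fin 2)) := automaton.perm .b

theorem stateAt_e (u : InfWord (Fin 2)) (n : ℕ) : automaton.stateAt .e u n = .e := by
  induction n with
  | zero => rfl
  | succ n ih =>
    change automaton.transition (automaton.stateAt .e u n) (u n) = .e
    rw [ih]
    rfl

theorem run_e (u : InfWord (Fin 2)) : automaton.run .e u = u := by
  funext n
  change automaton.output (automaton.stateAt .e u n) (u n) = u n
  rw [stateAt_e]
  rfl

theorem stateAt_succ (s : State) (u : InfWord (Fin 2)) (n : ℕ) :
    automaton.stateAt s u (n + 1)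
      = automaton.stateAt (automaton.transition s (u 0)) (shift u) n := by
  induction n with
  | zero => rfl
  | succ n ih =>
    rw [InvAutomaton.stateAt, ih]
    rfl

theorem shift_run (s : State) (u : InfWord (Fin 2)) :
    shift (automaton.run s u) = automaton.run (automaton.transition s (u 0)) (shift u) := by
  funext n
  simp only [shift, InvAutomaton.run, stateAt_succ]

@[simp] theorem permA_apply_zero (u : InfWord (Fin 2)) : permA u 0 = u 0 := rfl

theorem permB_apply_zero (u : InfWord (Fin 2)) : permB u 0 = Equiv.swap 0 1 (u 0) := rfl

theorem shift_permA_of_zero {u : InfWord (Fin 2)} (h : u 0 = 0) :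
    shift (permA u) = permB (shift u) := by
  have := shift_run .a u
  rw [h] at this
  exact this

theorem shift_permA_of_one {u : InfWord (Fin 2)} (h : u 0 = 1) :
    shift (permA u) = shift u := by
  have := shift_run .a u
  rw [h] at this
  exact this.trans (run_e _)

theorem permA_of_one {u : InfWord (Fin 2)} (h : u 0 = 1) : permA u = u :=
  ext_shift rfl (shift_permA_of_one h)

theorem shift_permB_of_zero {u : InfWord (Fin 2)} (h : u 0 = 0) :
    shift (permB u) = permA (shift u) := by
  have := shift_run .b u
  rw [h] at this
  exact this

theorem shift_permB_of_one {u : InfWord (Fin 2)} (h : u 0 = 1) :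
    shift (permB u) = shift u := by
  have := shift_run .b u
  rw [h] at this
  exact this.trans (run_e _)

/-- The generator `a` changes only letters at odd positions, and `b` only letters at even
positions, since the two states alternate. -/
theorem perm_apply_parity (k : ℕ) : ∀ u : InfWord (Fin 2),
    permA u (2 * k) = u (2 * k) ∧ permB u (2 * k + 1) = u (2 * k + 1) := by
  induction k with
  | zero =>
    intro u
    refine ⟨rfl, ?_⟩
    rcases eq_zero_or_one (u 0) with h | h
    · exact congrFun (shift_permB_of_zero h) 0
    · exact congrFun (shift_permB_of_one h) 0
  | succ k ih =>
    have hA : ∀ u : InfWord (Fin 2), permA u (2 * (k + 1)) = u (2 * (k + 1)) := by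
      intro u
      rcases eq_zero_or_one (u 0) with h | h
      · exact (congrFun (shift_permA_of_zero h) (2 * k + 1)).trans (ih (shift u)).2
      · exact congrFun (shift_permA_of_one h) (2 * k + 1)
    refine fun u => ⟨hA u, ?_⟩
    rcases eq_zero_or_one (u 0) with h | h
    · exact (congrFun (shift_permB_of_zero h) (2 * (k + 1))).trans (hA (shift u))
    · exact congrFun (shift_permB_of_one h) (2 * (k + 1))

theorem permA_apply_even (u : InfWord (Fin 2)) (k : ℕ) : permA u (2 * k) = u (2 * k) :=
  (perm_apply_parity k u).1

theorem permB_apply_odd (u : InfWord (Fin 2)) (k : ℕ) : permB u (2 * k + 1) = u (2 * k + 1) :=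
  (perm_apply_parity k u).2

/-- After reading a letter `1` the automaton is in its trivial state. -/
theorem perm_apply_of_one_lt (i : ℕ) : ∀ (u : InfWord (Fin 2)) (k : ℕ), u i = 1 → i < k →
    permA u k = u k ∧ permB u k = u k := by
  induction i with
  | zero =>
    intro u k h hk
    obtain ⟨k, rfl⟩ : ∃ m, k = m + 1 := ⟨k - 1, by omega⟩
    exact ⟨congrFun (shift_permA_of_one h) k, congrFun (shift_permB_of_one h) k⟩
  | succ i ih =>
    intro u k h hk
    obtain ⟨k, rfl⟩ : ∃ m, k = m + 1 := ⟨k - 1, by omega⟩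
    have := ih (shift u) k h (by omega)
    rcases eq_zero_or_one (u 0) with h0 | h0
    · exact ⟨(congrFun (shift_permA_of_zero h0) k).trans this.2,
        (congrFun (shift_permB_of_zero h0) k).trans this.1⟩
    · exact ⟨congrFun (shift_permA_of_one h0) k, congrFun (shift_permB_of_one h0) k⟩

theorem permA_apply_of_one_lt {u : InfWord (Fin 2)} {i k : ℕ} (h : u i = 1) (hk : i < k) :
    permA u k = u k :=
  (perm_apply_of_one_lt i u k h hk).1

theorem permB_apply_of_one_lt {u : InfWord (Fin 2)} {i k : ℕ} (h : u i = 1) (hk : i < k) :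
    permB u k = u k :=
  (perm_apply_of_one_lt i u k h hk).2

/-- A letter `1` at an even position makes the `a`-orbit finite, one at an odd position makes the
`b`-orbit finite: `b²` acts on `xw` as `a` on `w`, and `a` on `0w` as `b` on `w`. -/
theorem exists_iterate_eq_self (i : ℕ) : ∀ u : InfWord (Fin 2), u i = 1 →
    (Even i → ∃ m > 0, permA^[m] u = u) ∧ (Odd i → ∃ m > 0, permB^[m] u = u) := by
  have hA : ∀ (m : ℕ) (u : InfWord (Fin 2)), u 0 = 0 →
      (permA^[m] u) 0 = 0 ∧ shift (permA^[m] u) = permB^[m] (shift u) := by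
    intro m u h
    induction m with
    | zero => exact ⟨h, rfl⟩
    | succ m ih =>
      simp only [Function.iterate_succ_apply']
      exact ⟨ih.1, by rw [shift_permA_of_zero ih.1, ih.2]⟩
  have hB : ∀ u : InfWord (Fin 2),
      (permB (permB u)) 0 = u 0 ∧ shift (permB (permB u)) = permA (shift u) := by
    intro u
    refine ⟨by simp [permB_apply_zero], ?_⟩
    rcases eq_zero_or_one (u 0) with h | h
    · rw [shift_permB_of_one (by simp [permB_apply_zero, h]), shift_permB_of_zero h]
    · rw [shift_permB_of_zero (by simp [permB_apply_zero, h]), shift_permB_of_one h]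
  have hB' : ∀ (m : ℕ) (u : InfWord (Fin 2)),
      (permB^[2 * m] u) 0 = u 0 ∧ shift (permB^[2 * m] u) = permA^[m] (shift u) := by
    intro m u
    induction m with
    | zero => exact ⟨rfl, rfl⟩
    | succ m ih =>
      rw [mul_add_one]
      simp only [Function.iterate_succ_apply']
      exact ⟨by rw [(hB _).1, ih.1], by rw [(hB _).2, ih.2]⟩
  induction i with
  | zero => exact fun u h => ⟨fun _ => ⟨1, one_pos, permA_of_one h⟩, fun h => by simp at h⟩
  | succ i ih =>
    intro u h
    obtain ⟨ih₁, ih₂⟩ := ih (shift u) h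
    constructor
    · intro hi
      rcases eq_zero_or_one (u 0) with h0 | h0
      · obtain ⟨m, hm, e⟩ := ih₂ (by grind)
        obtain ⟨h1, h2⟩ := hA m u h0
        exact ⟨m, hm, ext_shift (h1.trans h0.symm) (h2.trans e)⟩
      · exact ⟨1, one_pos, permA_of_one h0⟩
    · intro hi
      obtain ⟨m, hm, e⟩ := ih₁ (by grind)
      obtain ⟨h1, h2⟩ := hB' m u
      exact ⟨2 * m, by omega, ext_shift h1 (h2.trans e)⟩

/-! ### Connectedness outside a set of words -/

/-- Adjacency in the Schreier graph on the set of all words, loops included. -/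
def Adj (u v : InfWord (Fin 2)) : Prop :=
  permA u = v ∨ permA v = u ∨ permB u = v ∨ permB v = u

theorem Adj.symm {u v : InfWord (Fin 2)} (h : Adj u v) : Adj v u := by
  unfold Adj at *
  tauto

/-- `Conn K u v`: the words `u` and `v` are joined by a path of the Schreier graph which avoids
`K`. The constant path is allowed even inside `K`. -/
def Conn (K : Set (InfWord (Fin 2))) : InfWord (Fin 2) → InfWord (Fin 2) → Prop :=
  ReflTransGen fun u v => Adj u v ∧ u ∉ K ∧ v ∉ K

theorem Conn.refl {K : Set (InfWord (Fin 2))} (u : InfWord (Fin 2)) : Conn K u u :=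
  ReflTransGen.refl

theorem Conn.symm {K : Set (InfWord (Fin 2))} {u v : InfWord (Fin 2)} (h : Conn K u v) :
    Conn K v u :=
  have : Std.Symm fun u v => Adj u v ∧ u ∉ K ∧ v ∉ K := ⟨fun _ _ h => ⟨h.1.symm, h.2.2, h.2.1⟩⟩
  ReflTransGen.stdSymm.symm _ _ h

theorem Conn.trans {K : Set (InfWord (Fin 2))} {u v w : InfWord (Fin 2)} (h : Conn K u v)
    (h' : Conn K v w) : Conn K u w :=
  ReflTransGen.trans h h'

theorem Conn.of_adj {K : Set (InfWord (Fin 2))} {u v : InfWord (Fin 2)} (h : Adj u v)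
    (hu : u ∉ K) (hv : v ∉ K) : Conn K u v :=
  ReflTransGen.single ⟨h, hu, hv⟩

theorem Conn.permA (u : InfWord (Fin 2)) : Conn ∅ u (permA u) :=
  .of_adj (.inl rfl) (by simp) (by simp)

theorem Conn.permB (u : InfWord (Fin 2)) : Conn ∅ u (permB u) :=
  .of_adj (.inr (.inr (.inl rfl))) (by simp) (by simp)

/-- The words `0w` and `1w` are adjacent, since `b(1w) = 0w`. -/
theorem conn_of_shift_eq {K : Set (InfWord (Fin 2))} {u v : InfWord (Fin 2)}
    (h : shift u = shift v) (hu : shift u ∉ K) : Conn (shift ⁻¹' K) u v := by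
  have key : ∀ u v : InfWord (Fin 2), shift u = shift v → u 0 = 1 → v 0 = 0 → Adj u v := by
    intro u v h hu hv
    refine .inr (.inr (.inl (ext_shift ?_ ?_)))
    · simp [permB_apply_zero, hu, hv]
    · rw [shift_permB_of_one hu, h]
  have hv : v ∉ shift ⁻¹' K := by rwa [Set.mem_preimage, ← h]
  rcases eq_zero_or_one (u 0) with h0 | h0 <;> rcases eq_zero_or_one (v 0) with h1 | h1
  · rw [ext_shift (h0.trans h1.symm) h]
    exact .refl _
  · exact .of_adj (key v u h.symm h1 h0).symm hu hv
  · exact .of_adj (key u v h h0 h1) hu hv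
  · rw [ext_shift (h0.trans h1.symm) h]
    exact .refl _

/-- Every edge of the Schreier graph is the image of an edge under the shift: `b(0w) = 1a(w)` and
`a(0w) = 0b(w)`. -/
theorem Adj.exists_lift {s t : InfWord (Fin 2)} (h : Adj s t) :
    ∃ u v, shift u = s ∧ shift v = t ∧ Adj u v := by
  have hA : ∀ s, permB (cons 0 s) = cons 1 (permA s) := fun s =>
    ext_shift (by simp [permB_apply_zero]) (shift_permB_of_zero rfl)
  have hB : ∀ s, permA (cons 0 s) = cons 0 (permB s) := fun s =>
    ext_shift (by simp) (shift_permA_of_zero rfl)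
  rcases h with rfl | rfl | rfl | rfl
  · exact ⟨cons 0 s, _, rfl, rfl, .inr (.inr (.inl (hA s)))⟩
  · exact ⟨_, cons 0 t, rfl, rfl, .inr (.inr (.inr (hA t)))⟩
  · exact ⟨cons 0 s, _, rfl, rfl, .inl (hB s)⟩
  · exact ⟨_, cons 0 t, rfl, rfl, .inr (.inl (hB t))⟩

/-- Self-similarity: the shift contracts the edges between `0w` and `1w` and turns the Schreier
graph into itself, so that connectedness outside `K` lifts along it. -/
theorem Conn.lift {K : Set (InfWord (Fin 2))} {s t : InfWord (Fin 2)} (h : Conn K s t)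
    (hs : s ∉ K) {u v : InfWord (Fin 2)} (hu : shift u = s) (hv : shift v = t) :
    Conn (shift ⁻¹' K) u v := by
  induction h generalizing v with
  | refl => exact conn_of_shift_eq (hu.trans hv.symm) (hu ▸ hs)
  | @tail t t' _ hstep ih =>
    obtain ⟨x, y, rfl, rfl, hxy⟩ := hstep.1.exists_lift
    exact (ih rfl).trans ((Conn.of_adj hxy hstep.2.1 hstep.2.2).trans
      (conn_of_shift_eq hv.symm hstep.2.2))

theorem Conn.lift_iterate {K : Set (InfWord (Fin 2))} (n : ℕ) {u v : InfWord (Fin 2)}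
    (h : Conn K (shift^[n] u) (shift^[n] v)) (hs : shift^[n] u ∉ K) :
    Conn (shift^[n] ⁻¹' K) u v := by
  induction n generalizing K with
  | zero => exact h
  | succ n ih =>
    rw [Function.iterate_succ', Set.preimage_comp]
    rw [Function.iterate_succ_apply'] at hs
    simp only [Function.iterate_succ_apply'] at h
    exact ih (h.lift hs rfl rfl) hs

theorem conn_of_shift_iterate_eq {n : ℕ} {u v : InfWord (Fin 2)}
    (h : shift^[n] u = shift^[n] v) : Conn ∅ u v := by
  have : Conn ∅ (shift^[n] u) (shift^[n] v) := h ▸ .refl _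
  simpa using this.lift_iterate n (by simp)

theorem Adj.conn_shift {u v : InfWord (Fin 2)} (h : Adj u v) : Conn ∅ (shift u) (shift v) := by
  have hA : ∀ u, Conn ∅ (shift u) (shift (Basilica.permA u)) := by
    intro u
    rcases eq_zero_or_one (u 0) with h | h
    · rw [shift_permA_of_zero h]
      exact .permB _
    · rw [shift_permA_of_one h]
      exact .refl _
  have hB : ∀ u, Conn ∅ (shift u) (shift (Basilica.permB u)) := by
    intro u
    rcases eq_zero_or_one (u 0) with h | h
    · rw [shift_permB_of_zero h]
      exact .permA _
    · rw [shift_permB_of_one h]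
      exact .refl _
  rcases h with rfl | rfl | rfl | rfl
  exacts [hA u, (hA v).symm, hB u, (hB v).symm]

theorem Conn.shift {u v : InfWord (Fin 2)} (h : Conn ∅ u v) :
    Conn ∅ (shift u) (shift v) := by
  induction h with
  | refl => exact .refl _
  | tail _ hstep ih => exact ih.trans hstep.1.conn_shift

theorem Conn.shift_iterate {u v : InfWord (Fin 2)} (h : Conn ∅ u v) (n : ℕ) :
    Conn ∅ (Basilica.shift^[n] u) (Basilica.shift^[n] v) := by
  induction n with
  | zero => exact h
  | succ n ih =>
    simp only [Function.iterate_succ_apply']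
    exact ih.shift

/-- A path which starts outside `A` and ends in `A` has a last vertex before it enters `A`. -/
theorem Conn.exists_exit {A : Set (InfWord (Fin 2))} {s t : InfWord (Fin 2)} (h : Conn ∅ s t)
    (ht : t ∈ A) (hs : s ∉ A) : ∃ c ∉ A, ∃ x ∈ A, Adj x c ∧ Conn A s c := by
  induction h using ReflTransGen.head_induction_on with
  | refl => exact absurd ht hs
  | @head s s' hstep _ ih =>
    by_cases hs' : s' ∈ A
    · exact ⟨s, hs, s', hs', hstep.1.symm, .refl _⟩
    · obtain ⟨c, hc, x, hx, hxc, hcon⟩ := ih hs'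
      exact ⟨c, hc, x, hx, hxc, (Conn.of_adj hstep.1 hs hs').trans hcon⟩

theorem mem_orbit_iff_conn {ξ u : InfWord (Fin 2)} :
    u ∈ MulAction.orbit basilicaGroup ξ ↔ Conn ∅ ξ u := by
  constructor
  · rintro ⟨⟨g, hg⟩, rfl⟩
    change Conn ∅ ξ (g ξ)
    induction hg using Subgroup.closure_induction generalizing ξ with
    | mem g hg =>
      rcases hg with rfl | rfl
      · exact .permA ξ
      · exact .permB ξ
    | one => exact .refl _
    | mul g h _ _ ihg ihh => exact (ihh (ξ := ξ)).trans ihg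
    | inv g _ ih => simpa using (ih (ξ := g⁻¹ ξ)).symm
  · have key : ∀ (g : basilicaGroup) (v : InfWord (Fin 2)),
        g • v ∈ MulAction.orbit basilicaGroup ξ ↔ v ∈ MulAction.orbit basilicaGroup ξ :=
      fun g v => by
        rw [← MulAction.orbit_eq_iff, MulAction.orbit_smul, MulAction.orbit_eq_iff]
    intro h
    induction h with
    | refl => exact MulAction.mem_orbit_self ξ
    | @tail u v _ hstep ih =>
      rcases hstep.1 with rfl | rfl | rfl | rfl
      · exact (key genA _).2 ih
      · exact (key genA _).1 ih
      · exact (key genB _).2 ih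
      · exact (key genB _).1 ih

theorem orbitalGraph_adj {ξ : InfWord (Fin 2)} {x y : MulAction.orbit basilicaGroup ξ} :
    (orbitalGraph ξ).Adj x y ↔ x ≠ y ∧ Adj x y := by
  have h : ∀ (g : basilicaGroup) (x y : MulAction.orbit basilicaGroup ξ),
      g • x = y ↔ g • (x : InfWord (Fin 2)) = y := fun g x y => by
    rw [Subtype.ext_iff, MulAction.orbit.coe_smul]
  have hA : ∀ u : InfWord (Fin 2), genA • u = permA u := fun _ => rfl
  have hB : ∀ u : InfWord (Fin 2), genB • u = permB u := fun _ => rfl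
  simp only [orbitalGraph, schreierGraph, SimpleGraph.fromRel_adj, Set.mem_insert_iff,
    Set.mem_singleton_iff, exists_eq_or_imp, exists_eq_left, h, hA, hB, Adj]
  tauto

/-! ### Counting the ends of a graph -/

section CountingEnds

variable {V : Type*} {G : SimpleGraph V}

/-- A ray eventually leaves every finite set, and then stays in one component. -/
theorem Ray.exists_forall_mem (R : Ray G) {K : Set V} (hK : K.Finite) :
    ∃ C : G.ComponentCompl K, ∃ N, ∀ n ≥ N, R.vertex n ∈ C := by
  obtain ⟨C, N, h⟩ := Ray.Equivalent.refl R K hK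
  exact ⟨C, N, fun n hn => (h n hn).1⟩

/-- If arbitrarily large finite sets `L` have the property that the complement of `L` can be
coloured with `m` colours in such a way that vertices of the same colour lie in the same component,
then there are at most `m` ends. -/
theorem numEnds_le (m : ℕ)
    (h : ∀ K : Set V, K.Finite → ∃ L : Set V, L.Finite ∧ K ⊆ L ∧ ∃ c : V → Fin m,
      ∀ u ∉ L, ∀ v ∉ L, c u = c v → ∃ C : G.ComponentCompl L, u ∈ C ∧ v ∈ C) :
    numEnds G ≤ m := by
  by_contra! hlt
  have hcard : ((m + 1 : ℕ) : ℕ∞) ≤ ENat.card (Ends G) := by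
    push_cast
    exact Order.add_one_le_of_lt hlt
  -- Otherwise there are `m + 1` pairwise inequivalent rays, separated by one finite set `K`.
  obtain ⟨f⟩ : Nonempty (Fin (m + 1) ↪ Ends G) := by
    rw [← Set.encard_univ] at hcard
    obtain ⟨t, -, ht⟩ := Set.exists_subset_encard_eq hcard
    have htfin : t.Finite := Set.finite_of_encard_eq_coe ht
    have htcard : Nat.card t = m + 1 := by
      rw [Nat.card_coe_set_eq, Set.ncard, ht]
      rfl
    have : Finite t := htfin
    exact ⟨(Finite.equivFinOfCardEq htcard).symm.toEmbedding.trans (.subtype _)⟩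
  let R : Fin (m + 1) → Ray G := fun i => (f i).out
  have hR : ∀ i j, i ≠ j → ¬ (R i).Equivalent (R j) := by
    intro i j hij he
    exact hij (f.injective (Quotient.out_equiv_out.1 he))
  have hK : ∀ i j, ∃ K : Set V, K.Finite ∧ (i ≠ j → ¬ ∃ C : G.ComponentCompl K, ∃ N : ℕ, ∀ n ≥ N,
      (R i).vertex n ∈ C ∧ (R j).vertex n ∈ C) := by
    intro i j
    by_cases hij : i = j
    · exact ⟨∅, Set.finite_empty, fun h => absurd hij h⟩
    · have := hR i j hij
      unfold Ray.Equivalent at this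
      push Not at this
      obtain ⟨K, hK, hne⟩ := this
      exact ⟨K, hK, fun _ ⟨C, N, hC⟩ => by
        obtain ⟨n, hn, h'⟩ := hne C N
        exact h' (hC n hn).1 (hC n hn).2⟩
  choose K hKfin hK using hK
  obtain ⟨L, hL, hKL, c, hc⟩ := h (⋃ i, ⋃ j, K i j)
    (Set.finite_iUnion fun i => Set.finite_iUnion fun j => hKfin i j)
  choose C N hC using fun i => (R i).exists_forall_mem hL
  obtain ⟨i, j, hij, hcol⟩ := Fintype.exists_ne_map_eq_of_card_lt
    (fun i => c ((R i).vertex (N i))) (by simp)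
  have hi := hC i _ le_rfl
  have hj := hC j _ le_rfl
  obtain ⟨D, hDi, hDj⟩ := hc _ (SimpleGraph.ComponentCompl.notMem_of_mem hi) _
    (SimpleGraph.ComponentCompl.notMem_of_mem hj) hcol
  have hCD : ∀ {C D : G.ComponentCompl L} {v : V}, v ∈ C → v ∈ D → C = D := by
    rintro C D v ⟨_, e⟩ ⟨_, e'⟩
    exact e.symm.trans e'
  have hsub : K i j ⊆ L := fun x hx => hKL (Set.mem_iUnion.2 ⟨i, Set.mem_iUnion.2 ⟨j, hx⟩⟩)
  refine hK i j hij ⟨D.hom hsub, max (N i) (N j), fun n hn => ?_⟩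
  refine ⟨D.subset_hom hsub ?_, D.subset_hom hsub ?_⟩
  · exact hCD hi hDi ▸ hC i n (le_of_max_le_left hn)
  · exact hCD hj hDj ▸ hC j n (le_of_max_le_right hn)

/-- Rays whose tails carry different values of a function that is constant along the edges
avoiding a finite set `K` represent different ends. -/
theorem le_numEnds {α : Type*} {m : ℕ} (K : Set V) (hK : K.Finite) (f : V → α)
    (hf : ∀ u ∉ K, ∀ v ∉ K, G.Adj u v → f u = f v) (R : Fin m → Ray G) (l : Fin m → α)
    (hl : Function.Injective l) (hR : ∀ i n, f ((R i).vertex (n + 1)) = l i) :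
    m ≤ numEnds G := by
  have hconst : ∀ (C : G.ComponentCompl K) (u v : V), u ∈ C → v ∈ C → f u = f v := by
    let F : G.ComponentCompl K → α := SimpleGraph.ComponentCompl.lift (fun v _ => f v)
      (fun v w hv hw h => hf v hv w hw h)
    have hF : ∀ (C : G.ComponentCompl K) (u : V), u ∈ C → f u = F C := by
      rintro _ u ⟨hu, rfl⟩
      rfl
    exact fun C u v hu hv => (hF C u hu).trans (hF C v hv).symm
  have hinj : Function.Injective fun i => (Quotient.mk (raySetoid G) (R i) : Ends G) := by
    intro i j hij
    obtain ⟨C, N, hC⟩ := (Quotient.exact hij : (R i).Equivalent (R j)) K hK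
    have := hC (N + 1) (by omega)
    exact hl ((hR i N).symm.trans ((hconst C _ _ this.1 this.2).trans (hR j N)))
  have := ENat.card_le_card_of_injective hinj
  rwa [ENat.card_eq_coe_fintype_card, Fintype.card_fin] at this

/-- An infinite connected graph with finite degrees has a ray: going away from a fixed vertex `o`,
one can always step to a vertex through which geodesics from `o` lead to infinitely many
vertices. -/
theorem exists_ray [Infinite V] (hG : G.Connected) (hfin : ∀ v, (G.neighborSet v).Finite) :
    Nonempty (Ray G) := by
  obtain ⟨o⟩ := hG.nonempty
  let D : V → Set V := fun v => {w | G.dist o w = G.dist o v + G.dist v w}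
  have step : ∀ v : {v // (D v).Infinite}, ∃ w : {v // (D v).Infinite},
      G.Adj v w ∧ G.dist o w = G.dist o v + 1 := by
    rintro ⟨v, hv⟩
    have hcover : D v ⊆ {v} ∪ ⋃ w ∈ {w ∈ G.neighborSet v | G.dist o w = G.dist o v + 1}, D w := by
      intro x hx
      change G.dist o x = G.dist o v + G.dist v x at hx
      obtain ⟨p, hp⟩ := (hG.preconnected v x).exists_walk_length_eq_dist
      cases p with
      | nil => exact .inl rfl
      | @cons _ w _ hvw q =>
        right
        have h1 : G.dist w x ≤ q.length := SimpleGraph.dist_le q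
        have h2 := hG.dist_triangle (u := o) (v := w) (w := x)
        have h3 := hG.dist_triangle (u := o) (v := v) (w := w)
        have h4 : G.dist v w = 1 := SimpleGraph.dist_eq_one_iff_adj.2 hvw
        rw [SimpleGraph.Walk.length_cons] at hp
        simp only [Set.mem_iUnion]
        refine ⟨w, ⟨hvw, by omega⟩, ?_⟩
        change G.dist o x = G.dist o w + G.dist w x
        omega
    by_contra! hcon
    refine hv (Set.Finite.subset ((Set.finite_singleton v).union
      (Set.Finite.biUnion ((hfin v).subset fun w hw => hw.1) ?_)) hcover)
    intro w hw
    by_contra hinf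
    exact hcon ⟨w, hinf⟩ hw.1 hw.2
  choose next hadj hdist using step
  let x : ℕ → {v // (D v).Infinite} := fun n => next^[n] ⟨o, by
    have : D o = Set.univ := by
      ext w
      simp [D]
    rw [this]
    exact Set.infinite_univ⟩
  have hx : ∀ n, x (n + 1) = next (x n) := fun n => Function.iterate_succ_apply' _ _ _
  have hd : ∀ n, G.dist o (x n) = n := by
    intro n
    induction n with
    | zero => exact SimpleGraph.dist_self
    | succ n ih => rw [hx, hdist, ih]
  refine ⟨⟨fun n => x n, fun m n h => ?_, fun n => ?_⟩⟩
  · have h : (x m : V) = x n := h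
    rw [← hd m, h, hd n]
  · rw [hx]
    exact hadj _

end CountingEnds

/-! ### Upper bounds for the number of ends -/

theorem Conn.mem_componentCompl {K : Set (InfWord (Fin 2))} {ξ : InfWord (Fin 2)}
    {x y : MulAction.orbit basilicaGroup ξ} (h : Conn K x y) (hx : (x : InfWord (Fin 2)) ∉ K) :
    y ∈ (orbitalGraph ξ).componentComplMk (K := Subtype.val ⁻¹' K) (v := x) hx := by
  obtain ⟨y, hy⟩ := y
  change Conn K x y at h
  induction h with
  | refl => exact (orbitalGraph ξ).componentComplMk_mem _
  | @tail u v _ hstep ih =>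
    have hu : u ∈ MulAction.orbit basilicaGroup ξ := by
      rw [mem_orbit_iff_conn] at hy ⊢
      exact hy.trans (Conn.of_adj hstep.1.symm (by simp) (by simp))
    by_cases huv : u = v
    · subst huv
      exact ih hu
    · refine SimpleGraph.ComponentCompl.mem_of_adj (⟨u, hu⟩ : MulAction.orbit basilicaGroup ξ)
        ⟨v, hy⟩ (ih hu) hstep.2.2 ?_
      exact orbitalGraph_adj.2 ⟨fun h => huv (congrArg Subtype.val h), hstep.1⟩

theorem finite_preimage_shift_iterate {A : Set (InfWord (Fin 2))} (hA : A.Finite) (n : ℕ) :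
    (shift^[n] ⁻¹' A).Finite := by
  have key : ∀ A : Set (InfWord (Fin 2)), A.Finite → (shift ⁻¹' A).Finite := by
    intro A hA
    refine ((hA.image (cons 0)).union (hA.image (cons 1))).subset fun u hu => ?_
    rcases eq_zero_or_one (u 0) with h | h
    · exact .inl ⟨shift u, hu, ext_shift h.symm rfl⟩
    · exact .inr ⟨shift u, hu, ext_shift h.symm rfl⟩
  induction n with
  | zero => exact hA
  | succ n ih =>
    rw [Function.iterate_succ, Set.preimage_comp]
    exact key _ ih

/-- By self-similarity, the components of `Γ_ξ` outside the words whose `n`-th shift lies in `A`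
can be counted in the graph of the `n`-th shift of `ξ`. -/
theorem numEnds_orbitalGraph_le {ξ : InfWord (Fin 2)} (m : ℕ) [NeZero m]
    (A : ℕ → Set (InfWord (Fin 2)))
    (hfin : ∀ n, (A n).Finite)
    (hexh : ∀ u, Conn ∅ ξ u → ∀ᶠ n in Filter.atTop, shift^[n] u ∈ A n)
    (hcov : ∃ᶠ n in Filter.atTop, ∃ c : Fin m → InfWord (Fin 2),
      ∀ s, Conn ∅ (shift^[n] ξ) s → s ∉ A n → ∃ i, Conn (A n) s (c i)) :
    numEnds (orbitalGraph ξ) ≤ m := by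
  refine numEnds_le m fun K hK => ?_
  have hev : ∀ᶠ n in Filter.atTop, ∀ x ∈ K, shift^[n] (x : InfWord (Fin 2)) ∈ A n :=
    (Filter.eventually_all_finite hK).2 fun x _ => hexh x (mem_orbit_iff_conn.1 x.2)
  obtain ⟨n, ⟨c, hc⟩, hn⟩ := (hcov.and_eventually hev).exists
  have hc' : ∀ x : MulAction.orbit basilicaGroup ξ, shift^[n] (x : InfWord (Fin 2)) ∉ A n →
      ∃ i, Conn (A n) (shift^[n] x) (c i) :=
    fun x => hc _ ((mem_orbit_iff_conn.1 x.2).shift_iterate n)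
  refine ⟨Subtype.val ⁻¹' (shift^[n] ⁻¹' A n),
    (finite_preimage_shift_iterate (hfin n) n).preimage Subtype.val_injective.injOn, hn, ?_⟩
  classical
  refine ⟨fun x => if h : _ then (hc' x h).choose else 0, fun u hu v hv huv => ?_⟩
  have hu' : shift^[n] (u : InfWord (Fin 2)) ∉ A n := hu
  have hv' : shift^[n] (v : InfWord (Fin 2)) ∉ A n := hv
  simp only [hu', hv', not_false_eq_true, dif_pos] at huv
  have h1 := (hc' u hu').choose_spec
  rw [huv] at h1
  have h2 := (h1.trans (hc' v hv').choose_spec.symm).lift_iterate n hu'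
  exact ⟨_, SimpleGraph.componentComplMk_mem _ _, h2.mem_componentCompl hu'⟩

/-! ### The height along an infinite orbit of a generator -/

/-- The ring `∏ₙ ℤ / 2ⁿ`, which contains the 2-adic integers. -/
abbrev TwoAdicSeq : Type := (n : ℕ) → ZMod (2 ^ n)

open Classical in
/-- The `k`-th binary digit of the potential of `b`: the letter at position `2k`, replaced by `0` if
a letter `1` occurs at a later odd position. -/
noncomputable def digit (u : InfWord (Fin 2)) (k : ℕ) : ℤ :=
  if u (2 * k) = 1 ∧ ∀ j ≥ k, u (2 * j + 1) = 0 then 1 else 0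

/-- The potential of `b`: the 2-adic integer with binary digits `digit u k`, given by its
residues. -/
noncomputable def potB (u : InfWord (Fin 2)) : TwoAdicSeq :=
  fun n => ((∑ k ∈ Finset.range n, digit u k * 2 ^ k : ℤ) : ZMod (2 ^ n))

/-- The potential of `a`, transported from `b` along the shift, as `a(0w) = 0b(w)`. -/
noncomputable def potA (u : InfWord (Fin 2)) : TwoAdicSeq := potB (shift u)

/-- The words all of whose odd positions carry `0`; these are the words with an infinite
`b`-orbit. -/
def lineB : Set (InfWord (Fin 2)) := {u | ∀ j, u (2 * j + 1) = 0}

/-- The words all of whose even positions carry `0`; these are the words with an infinite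
`a`-orbit. -/
def lineA : Set (InfWord (Fin 2)) := {u | ∀ j, u (2 * j) = 0}

theorem digit_congr {u v : InfWord (Fin 2)} {k l : ℕ}
    (h : (u (2 * k) = 1 ∧ ∀ j ≥ k, u (2 * j + 1) = 0) ↔
      (v (2 * l) = 1 ∧ ∀ j ≥ l, v (2 * j + 1) = 0)) : digit u k = digit v l := by
  rw [digit, digit]
  classical exact if_congr h rfl rfl

theorem potB_congr {u v : InfWord (Fin 2)} (h : ∀ k, digit u k = digit v k) : potB u = potB v := by
  funext n
  simp only [potB, h]

theorem potB_permA (u : InfWord (Fin 2)) : potB (permA u) = potB u := by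
  refine potB_congr fun k => digit_congr ?_
  rw [permA_apply_even]
  refine and_congr_right fun h => forall₂_congr fun j hj => ?_
  rw [permA_apply_of_one_lt h (by omega)]

theorem potB_permB_of_notMem {u : InfWord (Fin 2)} (hu : u ∉ lineB) :
    potB (permB u) = potB u := by
  obtain ⟨i, hi⟩ : ∃ i, u (2 * i + 1) = 1 := by
    simp only [lineB, Set.mem_ofPred_eq, not_forall] at hu
    obtain ⟨i, hi⟩ := hu
    exact ⟨i, (eq_zero_or_one _).resolve_left hi⟩
  refine potB_congr fun k => digit_congr ?_
  simp only [permB_apply_odd]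
  refine and_congr_left fun h => ?_
  have hik : i < k := by
    by_contra hki
    simp [h i (by omega)] at hi
  rw [permB_apply_of_one_lt hi (by omega)]

theorem permB_mem_lineB_iff {u : InfWord (Fin 2)} : permB u ∈ lineB ↔ u ∈ lineB := by
  simp [lineB, permB_apply_odd]

theorem permA_mem_lineA_iff {u : InfWord (Fin 2)} : permA u ∈ lineA ↔ u ∈ lineA := by
  simp [lineA, permA_apply_even]

theorem shift_mem_lineB {u : InfWord (Fin 2)} (hu : u ∈ lineA) : shift u ∈ lineB :=
  fun j => hu (j + 1)

theorem digit_of_mem_lineB {u : InfWord (Fin 2)} (hu : u ∈ lineB) (k : ℕ) :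
    digit u k = if u (2 * k) = 1 then 1 else 0 := by
  rw [digit]
  classical exact if_congr (and_iff_left fun j _ => hu j) rfl rfl

theorem sum_digit_succ (u : InfWord (Fin 2)) (n : ℕ) :
    ∑ k ∈ Finset.range (n + 1), digit u k * 2 ^ k
      = digit u 0 + 2 * ∑ k ∈ Finset.range n, digit (shift (shift u)) k * 2 ^ k := by
  rw [Finset.sum_range_succ', add_comm, Finset.mul_sum]
  congr 1
  · simp
  · refine Finset.sum_congr rfl fun k _ => ?_
    have : digit (shift (shift u)) k = digit u (k + 1) := by
      refine digit_congr (and_congr_right fun _ => ⟨fun h j hj => ?_, fun h j hj => ?_⟩)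
      · obtain ⟨j, rfl⟩ : ∃ i, j = i + 1 := ⟨j - 1, by omega⟩
        exact h j (by omega)
      · exact h (j + 1) (by omega)
    rw [this]
    ring

/-- On the words with zeros at the odd positions, `b` acts as the inverse of the binary adding
machine: `b(00w) = 10b(w)` and `b(10w) = 00w`. -/
theorem sum_digit_permB (n : ℕ) : ∀ u ∈ lineB,
    (2 ^ n : ℤ) ∣ (∑ k ∈ Finset.range n, digit (permB u) k * 2 ^ k)
      - ((∑ k ∈ Finset.range n, digit u k * 2 ^ k) - 1) := by
  induction n with
  | zero => simp
  | succ n ih =>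
    intro u hu
    have hu2 : shift (shift u) ∈ lineB := fun j => hu (j + 1)
    rw [sum_digit_succ, sum_digit_succ, digit_of_mem_lineB hu,
      digit_of_mem_lineB (permB_mem_lineB_iff.2 hu), mul_zero, permB_apply_zero]
    rcases eq_zero_or_one (u 0) with h | h
    · have : shift (shift (permB u)) = permB (shift (shift u)) := by
        rw [shift_permB_of_zero h, shift_permA_of_zero (hu 0)]
      obtain ⟨c, hc⟩ := ih _ hu2
      refine ⟨c, ?_⟩
      rw [this, h, pow_succ]
      simp only [Equiv.swap_apply_left, zero_ne_one, if_true, if_false]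
      linear_combination 2 * hc
    · rw [shift_permB_of_one h, h]
      simp

theorem potB_permB_of_mem {u : InfWord (Fin 2)} (hu : u ∈ lineB) :
    potB (permB u) = potB u - 1 := by
  funext n
  have h := (ZMod.intCast_zmod_eq_zero_iff_dvd _ _).2
    (by exact_mod_cast sum_digit_permB n u hu)
  rw [Int.cast_sub, Int.cast_sub, Int.cast_one, sub_eq_zero] at h
  exact h

theorem eq_of_potB_eq {u v : InfWord (Fin 2)} (hu : u ∈ lineB) (hv : v ∈ lineB)
    (h : potB u = potB v) : u = v := by
  have hdvd : ∀ n, (2 ^ n : ℤ) ∣ (∑ k ∈ Finset.range n, digit v k * 2 ^ k)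
      - ∑ k ∈ Finset.range n, digit u k * 2 ^ k := by
    intro n
    have := (ZMod.intCast_eq_intCast_iff_dvd_sub _ _ _).1 (congrFun h n)
    exact_mod_cast this
  have heven : ∀ k, u (2 * k) = v (2 * k) := by
    intro k
    induction k using Nat.strong_induction_on with
    | _ k ih =>
      have hsum : ∑ i ∈ Finset.range k, digit v i * 2 ^ i
          = ∑ i ∈ Finset.range k, digit u i * 2 ^ i := by
        refine Finset.sum_congr rfl fun i hi => ?_
        rw [digit_of_mem_lineB hu, digit_of_mem_lineB hv, ih i (Finset.mem_range.1 hi)]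
      have hk := hdvd (k + 1)
      rw [Finset.sum_range_succ, Finset.sum_range_succ, hsum, add_sub_add_left_eq_sub, ← sub_mul,
        pow_succ'] at hk
      have h2 := Int.dvd_of_mul_dvd_mul_right (by positivity) hk
      rw [digit_of_mem_lineB hu, digit_of_mem_lineB hv] at h2
      rcases eq_zero_or_one (u (2 * k)) with h0 | h0 <;>
        rcases eq_zero_or_one (v (2 * k)) with h1 | h1 <;> simp [h0, h1] at h2 ⊢
  funext n
  obtain ⟨k, rfl | rfl⟩ := Nat.even_or_odd' n
  · exact heven k
  · rw [hu k, hv k]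

/-- The properties of a potential `ρ` for a generator `g` with respect to the other generator `h`:
it is invariant under `h`, and `g` decreases it by `1` on the `g`-invariant set `L` and preserves it
elsewhere; on `L` it is injective. The field `adj_iff` says that `g` and `h` are the two
generators. -/
structure IsPotential (g h : Equiv.Perm (InfWord (Fin 2))) (L : Set (InfWord (Fin 2)))
    (ρ : InfWord (Fin 2) → TwoAdicSeq) : Prop where
  adj_iff : ∀ u v, Adj u v ↔ (g u = v ∨ g v = u) ∨ h u = v ∨ h v = u
  mem_iff : ∀ u, g u ∈ L ↔ u ∈ L
  invariant : ∀ u, ρ (h u) = ρ u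
  apply_of_mem : ∀ u ∈ L, ρ (g u) = ρ u - 1
  apply_of_notMem : ∀ u ∉ L, ρ (g u) = ρ u
  injOn : Set.InjOn ρ L

theorem isPotential_potB : IsPotential permB permA lineB potB where
  adj_iff u v := by unfold Adj; tauto
  mem_iff u := permB_mem_lineB_iff
  invariant := potB_permA
  apply_of_mem u := potB_permB_of_mem
  apply_of_notMem u := potB_permB_of_notMem
  injOn u hu v hv := eq_of_potB_eq hu hv

theorem isPotential_potA : IsPotential permA permB lineA potA where
  adj_iff u v := by unfold Adj; tauto
  mem_iff u := permA_mem_lineA_iff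
  invariant u := by
    unfold potA
    rcases eq_zero_or_one (u 0) with h | h
    · rw [shift_permB_of_zero h, potB_permA]
    · rw [shift_permB_of_one h]
  apply_of_mem u hu := by
    unfold potA
    rw [shift_permA_of_zero (hu 0), potB_permB_of_mem (shift_mem_lineB hu)]
  apply_of_notMem u hu := by
    unfold potA
    rcases eq_zero_or_one (u 0) with h | h
    · rw [shift_permA_of_zero h, potB_permB_of_notMem]
      intro hs
      refine hu fun j => ?_
      cases j with
      | zero => exact h
      | succ j => exact hs j
    · rw [shift_permA_of_one h]
  injOn u hu v hv h :=
    ext_shift ((hu 0).trans (hv 0).symm) (eq_of_potB_eq (shift_mem_lineB hu) (shift_mem_lineB hv) h)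

theorem intCast_twoAdicSeq_injective : Function.Injective (Int.cast : ℤ → TwoAdicSeq) := by
  intro m n h
  have hdvd : ∀ k : ℕ, (2 ^ k : ℤ) ∣ n - m := fun k => by
    have := (ZMod.intCast_eq_intCast_iff_dvd_sub m n (2 ^ k)).1 (by simpa using congrFun h k)
    exact_mod_cast this
  have : n - m = 0 := by
    refine Int.eq_zero_of_abs_lt_dvd (hdvd (n - m).natAbs) ?_
    rw [Int.abs_eq_natAbs]
    exact_mod_cast Nat.lt_two_pow_self
  omega

open Classical in
/-- The height of a word `u` above the base point `t`: the integer by which the potentials of `u`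
and `t` differ, and `0` if they do not differ by an integer (which does not happen in the orbit
of `t`). -/
noncomputable def height (ρ : InfWord (Fin 2) → TwoAdicSeq) (t u : InfWord (Fin 2)) : ℤ :=
  if h : ∃ n : ℤ, ρ u = ρ t + n then h.choose else 0

theorem height_eq {ρ : InfWord (Fin 2) → TwoAdicSeq} {t u : InfWord (Fin 2)} {n : ℤ}
    (h : ρ u = ρ t + n) : height ρ t u = n := by
  have hex : ∃ n : ℤ, ρ u = ρ t + n := ⟨n, h⟩
  rw [height, dif_pos hex]
  exact intCast_twoAdicSeq_injective (add_left_cancel (hex.choose_spec.symm.trans h))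

namespace IsPotential

variable {g h : Equiv.Perm (InfWord (Fin 2))} {L : Set (InfWord (Fin 2))}
  {ρ : InfWord (Fin 2) → TwoAdicSeq} {t u v : InfWord (Fin 2)}

theorem spec_height (hρ : IsPotential g h L ρ) (hu : Conn ∅ t u) :
    ρ u = ρ t + height ρ t u := by
  suffices hex : ∃ n : ℤ, ρ u = ρ t + n by
    obtain ⟨n, hn⟩ := hex
    rw [height_eq hn, hn]
  have hg : ∀ v, ∃ n : ℤ, ρ (g v) = ρ v + n := by
    intro v
    by_cases hv : v ∈ L
    · exact ⟨-1, by rw [hρ.apply_of_mem v hv]; push_cast; ring⟩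
    · exact ⟨0, by rw [hρ.apply_of_notMem v hv]; simp⟩
  induction hu with
  | refl => exact ⟨0, by simp⟩
  | @tail v w _ hstep ih =>
    obtain ⟨n, hn⟩ := ih
    rcases (hρ.adj_iff v w).1 hstep.1 with (rfl | rfl) | rfl | rfl
    · obtain ⟨k, hk⟩ := hg v
      exact ⟨n + k, by rw [hk, hn]; push_cast; ring⟩
    · obtain ⟨k, hk⟩ := hg w
      exact ⟨n - k, by rw [eq_sub_of_add_eq hk.symm, hn]; push_cast; ring⟩
    · exact ⟨n, by rw [hρ.invariant, hn]⟩
    · exact ⟨n, by rw [← hρ.invariant, hn]⟩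

/-- The only edges along which the height changes are those of the line `L`, which pass through all
heights one by one; so the sign of the height cannot change away from the base point. -/
theorem sign_height_eq (hρ : IsPotential g h L ρ) (ht : t ∈ L) (hu : Conn ∅ t u)
    (hut : u ≠ t) (hvt : v ≠ t) (huv : Adj u v) :
    SignType.sign (height ρ t u) = SignType.sign (height ρ t v) := by
  have key : ∀ u, Conn ∅ t u → u ≠ t → g u ≠ t →
      SignType.sign (height ρ t u) = SignType.sign (height ρ t (g u)) := by
    intro u hu hut hgt
    have hs := hρ.spec_height hu
    by_cases huL : u ∈ L
    · have hs' : ρ (g u) = ρ t + ((height ρ t u - 1 : ℤ) : TwoAdicSeq) := by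
        rw [hρ.apply_of_mem u huL, hs]
        push_cast
        ring
      rw [height_eq hs']
      have h0 : height ρ t u ≠ 0 := fun h0 => hut (hρ.injOn huL ht (by rw [hs, h0]; simp))
      have h1 : height ρ t u - 1 ≠ 0 := fun h1 =>
        hgt (hρ.injOn ((hρ.mem_iff u).2 huL) ht (by rw [hs', h1]; simp))
      rcases lt_or_gt_of_ne h0 with h2 | h2
      · rw [sign_neg h2, sign_neg (by omega)]
      · rw [sign_pos h2, sign_pos (by omega)]
    · rw [height_eq (u := g u) (by rw [hρ.apply_of_notMem u huL, hs])]
  have hv : Conn ∅ t v := hu.trans (.of_adj huv (by simp) (by simp))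
  have hinv : ∀ u, Conn ∅ t u → height ρ t (h u) = height ρ t u := fun u hu =>
    height_eq (by rw [hρ.invariant, ← hρ.spec_height hu])
  rcases (hρ.adj_iff u v).1 huv with (rfl | rfl) | rfl | rfl
  · exact key u hu hut hvt
  · exact (key v hv hvt hut).symm
  · rw [hinv u hu]
  · rw [hinv v hv]

theorem iterate_mem (hρ : IsPotential g h L ρ) (ht : t ∈ L) (n : ℕ) : g^[n] t ∈ L := by
  induction n with
  | zero => exact ht
  | succ n ih => rwa [Function.iterate_succ_apply', hρ.mem_iff]

theorem iterate_symm_mem (hρ : IsPotential g h L ρ) (ht : t ∈ L) (n : ℕ) : g.symm^[n] t ∈ L := by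
  induction n with
  | zero => exact ht
  | succ n ih => rwa [Function.iterate_succ_apply', ← hρ.mem_iff, Equiv.apply_symm_apply]

theorem height_iterate (hρ : IsPotential g h L ρ) (ht : t ∈ L) (n : ℕ) :
    height ρ t (g^[n] t) = -n := by
  refine height_eq ?_
  induction n with
  | zero => simp
  | succ n ih =>
    rw [Function.iterate_succ_apply', hρ.apply_of_mem _ (hρ.iterate_mem ht n), ih]
    push_cast
    ring

theorem height_iterate_symm (hρ : IsPotential g h L ρ) (ht : t ∈ L) (n : ℕ) :
    height ρ t (g.symm^[n] t) = n := by
  refine height_eq ?_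
  induction n with
  | zero => simp
  | succ n ih =>
    have := hρ.apply_of_mem _ (hρ.iterate_symm_mem ht (n + 1))
    rw [Function.iterate_succ_apply', Equiv.apply_symm_apply, ih] at this
    rw [Function.iterate_succ_apply', eq_add_of_sub_eq this.symm]
    push_cast
    ring

end IsPotential

/-! ### Lower bounds for the number of ends -/

/-- The ray of `Γ_ξ` given by a sequence of distinct words in the orbit of `ξ`. -/
def orbitRay {ξ : InfWord (Fin 2)} (x : ℕ → InfWord (Fin 2)) (h₀ : Conn ∅ ξ (x 0))
    (hinj : Function.Injective x) (hadj : ∀ n, Adj (x n) (x (n + 1))) : Ray (orbitalGraph ξ) where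
  vertex n := ⟨x n, mem_orbit_iff_conn.2 <| by
    induction n with
    | zero => exact h₀
    | succ n ih => exact ih.trans (.of_adj (hadj n) (by simp) (by simp))⟩
  injective _ _ h := hinj (congrArg Subtype.val h)
  adj n := orbitalGraph_adj.2
    ⟨fun h => n.succ_ne_self (hinj (congrArg Subtype.val h)).symm, hadj n⟩

namespace IsPotential

variable {g h : Equiv.Perm (InfWord (Fin 2))} {L : Set (InfWord (Fin 2))}
  {ρ : InfWord (Fin 2) → TwoAdicSeq} {ξ t : InfWord (Fin 2)}

/-- The ray `t, g(t), g²(t), …`. -/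
def ray (hρ : IsPotential g h L ρ) (ht : t ∈ L) (hξ : Conn ∅ ξ t) : Ray (orbitalGraph ξ) :=
  orbitRay (fun n => g^[n] t) hξ
    (fun m n hmn => by
      have := congrArg (height ρ t) hmn
      simp only [hρ.height_iterate ht] at this
      omega)
    (fun n => (hρ.adj_iff _ _).2 (.inl (.inl (Function.iterate_succ_apply' g n t).symm)))

/-- The ray `t, g⁻¹(t), g⁻²(t), …`. -/
def raySymm (hρ : IsPotential g h L ρ) (ht : t ∈ L) (hξ : Conn ∅ ξ t) : Ray (orbitalGraph ξ) :=
  orbitRay (fun n => g.symm^[n] t) hξ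
    (fun m n hmn => by
      have := congrArg (height ρ t) hmn
      simp only [hρ.height_iterate_symm ht] at this
      omega)
    (fun n => (hρ.adj_iff _ _).2 (.inl (.inr (by
      rw [Function.iterate_succ_apply', Equiv.apply_symm_apply]))))

theorem sign_height_iterate (hρ : IsPotential g h L ρ) (ht : t ∈ L) (n : ℕ) :
    SignType.sign (height ρ t (g^[n + 1] t)) = -1 := by
  rw [hρ.height_iterate ht, sign_neg (by push_cast; omega)]

theorem sign_height_iterate_symm (hρ : IsPotential g h L ρ) (ht : t ∈ L) (n : ℕ) :
    SignType.sign (height ρ t (g.symm^[n + 1] t)) = 1 := by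
  rw [hρ.height_iterate_symm ht, sign_pos (by push_cast; omega)]

theorem height_iterate_other (hρ : IsPotential g h L ρ) (n : ℕ) :
    height ρ t (h^[n] t) = 0 := by
  refine height_eq ?_
  induction n with
  | zero => simp
  | succ n ih => rw [Function.iterate_succ_apply', hρ.invariant, ih]

theorem height_iterate_symm_other (hρ : IsPotential g h L ρ) (n : ℕ) :
    height ρ t (h.symm^[n] t) = 0 := by
  refine height_eq ?_
  induction n with
  | zero => simp
  | succ n ih =>
    rw [Function.iterate_succ_apply', ← hρ.invariant, Equiv.apply_symm_apply, ih]

theorem sign_height_eq_of_adj (hρ : IsPotential g h L ρ) (ht : t ∈ L) (hξ : Conn ∅ ξ t)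
    {x y : MulAction.orbit basilicaGroup ξ}
    (hx : x ∉ (Subtype.val ⁻¹' {t} : Set (MulAction.orbit basilicaGroup ξ)))
    (hy : y ∉ (Subtype.val ⁻¹' {t} : Set (MulAction.orbit basilicaGroup ξ)))
    (hxy : (orbitalGraph ξ).Adj x y) :
    SignType.sign (height ρ t x) = SignType.sign (height ρ t y) :=
  hρ.sign_height_eq ht (hξ.symm.trans (mem_orbit_iff_conn.1 x.2)) hx hy (orbitalGraph_adj.1 hxy).2

/-- An infinite orbit of a generator has two ends, separated by any of its vertices. -/
theorem two_le_numEnds (hρ : IsPotential g h L ρ) (ht : t ∈ L) (hξ : Conn ∅ ξ t) :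
    2 ≤ numEnds (orbitalGraph ξ) := by
  refine le_numEnds (m := 2) (Subtype.val ⁻¹' {t})
    ((Set.finite_singleton t).preimage Subtype.val_injective.injOn)
    (fun x => SignType.sign (height ρ t x))
    (fun x hx y hy hxy => hρ.sign_height_eq_of_adj ht hξ hx hy hxy)
    ![hρ.ray ht hξ, hρ.raySymm ht hξ] ![-1, 1] (by decide) fun i n => ?_
  fin_cases i
  · exact hρ.sign_height_iterate ht n
  · exact hρ.sign_height_iterate_symm ht n

end IsPotential

/-- Two infinite orbits of the generators which cross in a vertex have four ends, separated by
that vertex. -/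
theorem four_le_numEnds {ξ t : InfWord (Fin 2)} (hA : t ∈ lineA) (hB : t ∈ lineB)
    (hξ : Conn ∅ ξ t) : 4 ≤ numEnds (orbitalGraph ξ) := by
  have pA := isPotential_potA
  have pB := isPotential_potB
  refine le_numEnds (m := 4) (Subtype.val ⁻¹' {t})
    ((Set.finite_singleton t).preimage Subtype.val_injective.injOn)
    (fun x => (SignType.sign (height potA t x), SignType.sign (height potB t x)))
    (fun x hx y hy hxy => by
      rw [pA.sign_height_eq_of_adj hA hξ hx hy hxy, pB.sign_height_eq_of_adj hB hξ hx hy hxy])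
    ![pA.ray hA hξ, pA.raySymm hA hξ, pB.ray hB hξ, pB.raySymm hB hξ]
    ![(-1, 0), (1, 0), (0, -1), (0, 1)] (by decide) fun i n => ?_
  fin_cases i
  · exact Prod.ext (pA.sign_height_iterate hA n)
      ((congrArg _ (pB.height_iterate_other (n + 1))).trans sign_zero)
  · exact Prod.ext (pA.sign_height_iterate_symm hA n)
      ((congrArg _ (pB.height_iterate_symm_other (n + 1))).trans sign_zero)
  · exact Prod.ext ((congrArg _ (pA.height_iterate_other (n + 1))).trans sign_zero)
      (pB.sign_height_iterate hB n)
  · exact Prod.ext ((congrArg _ (pA.height_iterate_symm_other (n + 1))).trans sign_zero)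
      (pB.sign_height_iterate_symm hB n)

theorem orbitalGraph_connected (ξ : InfWord (Fin 2)) : (orbitalGraph ξ).Connected := by
  have key : ∀ u (hu : u ∈ MulAction.orbit basilicaGroup ξ),
      (orbitalGraph ξ).Reachable ⟨ξ, MulAction.mem_orbit_self ξ⟩ ⟨u, hu⟩ := by
    intro u hu
    have h := mem_orbit_iff_conn.1 hu
    induction h with
    | refl => exact .refl _
    | @tail u v h hstep ih =>
      by_cases huv : u = v
      · subst huv
        exact ih hu
      · refine (ih (mem_orbit_iff_conn.2 h)).trans (SimpleGraph.Adj.reachable ?_)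
        exact orbitalGraph_adj.2 ⟨fun h => huv (congrArg Subtype.val h), hstep.1⟩
  have : Nonempty (MulAction.orbit basilicaGroup ξ) := ⟨⟨ξ, MulAction.mem_orbit_self ξ⟩⟩
  exact ⟨fun x y => (key x x.2).symm.trans (key y y.2)⟩

theorem infinite_orbit (ξ : InfWord (Fin 2)) : Infinite (MulAction.orbit basilicaGroup ξ) := by
  refine Infinite.of_injective (fun k : ℕ =>
    (⟨Function.update ξ k (ξ k + 1),
      mem_orbit_iff_conn.2 (conn_of_shift_iterate_eq (n := k + 1) ?_)⟩ :
        MulAction.orbit basilicaGroup ξ)) ?_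
  · funext i
    rw [shift_iterate_apply, shift_iterate_apply, Function.update_of_ne (by omega)]
  · intro k l h
    by_contra hkl
    have := congrFun (congrArg Subtype.val h) k
    simp [Function.update_of_ne hkl] at this

theorem one_le_numEnds (ξ : InfWord (Fin 2)) : 1 ≤ numEnds (orbitalGraph ξ) := by
  have := infinite_orbit ξ
  obtain ⟨R⟩ := exists_ray (orbitalGraph_connected ξ) fun x => by
    have hfin : ({permA x, permA.symm x, permB x, permB.symm x} : Set (InfWord (Fin 2))).Finite :=
      Set.toFinite _
    refine (hfin.preimage Subtype.val_injective.injOn).subset fun y hy => ?_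
    rcases (orbitalGraph_adj.1 hy).2 with h | h | h | h
    · simp [← h]
    · simp [← h]
    · simp [← h]
    · simp [← h]
  exact le_numEnds (m := 1) ∅ Set.finite_empty (fun _ => ()) (by simp) (fun _ => R) (fun _ => ())
    (Function.injective_of_subsingleton _) (by simp)

/-! ### The orbit of `0^ω` -/

/-- The word `(10)^ω`. -/
def oneZeros : InfWord (Fin 2) := cons 1 zeroOnes

theorem shift_zeros : shift zeros = zeros := rfl

theorem shift_oneZeros : shift oneZeros = zeroOnes := rfl

theorem shift_zeroOnes : shift zeroOnes = oneZeros := by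
  funext n
  cases n with
  | zero => rfl
  | succ n => simp [shift, oneZeros, cons, zeroOnes, Nat.even_add_one]

theorem perm_zeros_apply (n : ℕ) : permA zeros n = zeroOnes n ∧ permB zeros n = oneZeros n := by
  induction n with
  | zero => exact ⟨rfl, rfl⟩
  | succ n ih =>
    constructor
    · change shift (permA zeros) n = shift zeroOnes n
      rw [shift_permA_of_zero rfl, shift_zeroOnes, shift_zeros, ih.2]
    · change shift (permB zeros) n = shift oneZeros n
      rw [shift_permB_of_zero rfl, shift_oneZeros, shift_zeros, ih.1]

theorem permA_zeros : permA zeros = zeroOnes := funext fun n => (perm_zeros_apply n).1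

theorem permB_zeros : permB zeros = oneZeros := funext fun n => (perm_zeros_apply n).2

theorem permA_oneZeros : permA oneZeros = oneZeros := permA_of_one rfl

theorem permA_cons_one (u : InfWord (Fin 2)) : permA (cons 1 u) = cons 1 u := permA_of_one rfl

theorem permB_zeroOnes : permB zeroOnes = cons 1 oneZeros := by
  refine ext_shift rfl ?_
  rw [shift_permB_of_zero rfl, shift_zeroOnes, permA_oneZeros, shift_cons]

theorem permB_cons_one_oneZeros : permB (cons 1 oneZeros) = zeroOnes := by
  refine ext_shift rfl ?_
  rw [shift_permB_of_one rfl, shift_zeroOnes, shift_cons]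

/-- The vertices `0^ω`, `(01)^ω`, `(10)^ω` and `11(01)^ω`. Outside of them the orbit of `0^ω` falls
into four infinite components. -/
def core : Set (InfWord (Fin 2)) := {zeros, zeroOnes, oneZeros, cons 1 oneZeros}

theorem shift_mem_core {u : InfWord (Fin 2)} (hu : u ∈ core) : shift u ∈ core := by
  rcases hu with rfl | rfl | rfl | rfl
  · exact .inl rfl
  · rw [shift_zeroOnes]
    exact .inr (.inr (.inl rfl))
  · exact .inr (.inl rfl)
  · exact .inr (.inr (.inl rfl))

/-- The words with a tail in `core`; they form the orbit of `0^ω`. -/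
def coreTails : Set (InfWord (Fin 2)) := {u | ∃ n, shift^[n] u ∈ core}

theorem eventually_shift_iterate_mem_core {u : InfWord (Fin 2)} (hu : u ∈ coreTails) :
    ∀ᶠ n in Filter.atTop, shift^[n] u ∈ core := by
  obtain ⟨N, hN⟩ := hu
  refine Filter.eventually_atTop.2 ⟨N, fun n hn => ?_⟩
  induction n, hn using Nat.le_induction with
  | base => exact hN
  | succ n _ ih =>
    rw [Function.iterate_succ_apply']
    exact shift_mem_core ih

theorem mem_coreTails_congr {u v : InfWord (Fin 2)} {n : ℕ} (h : shift^[n] u = shift^[n] v)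
    (hu : u ∈ coreTails) : v ∈ coreTails := by
  obtain ⟨m, hm, hn⟩ :=
    ((eventually_shift_iterate_mem_core hu).and (Filter.eventually_ge_atTop n)).exists
  refine ⟨m, ?_⟩
  obtain ⟨k, rfl⟩ := Nat.exists_eq_add_of_le' hn
  rwa [Function.iterate_add_apply, ← h, ← Function.iterate_add_apply]

theorem conn_zeros_of_mem_coreTails {u : InfWord (Fin 2)} (hu : u ∈ coreTails) :
    Conn ∅ u zeros := by
  have h1 : Conn ∅ zeroOnes zeros := by
    rw [← permA_zeros]
    exact (Conn.permA _).symm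
  have h2 : Conn ∅ oneZeros zeros := by
    rw [← permB_zeros]
    exact (Conn.permB _).symm
  have h0 : ∀ n, shift^[n] zeros = zeros := fun n => Function.iterate_fixed shift_zeros n
  have halt : ∀ n, (shift^[n] zeroOnes = zeroOnes ∧ shift^[n] oneZeros = oneZeros) ∨
      (shift^[n] zeroOnes = oneZeros ∧ shift^[n] oneZeros = zeroOnes) := by
    intro n
    induction n with
    | zero => exact .inl ⟨rfl, rfl⟩
    | succ n ih =>
      simp only [Function.iterate_succ_apply']
      rcases ih with ⟨e1, e2⟩ | ⟨e1, e2⟩ <;> rw [e1, e2, shift_zeroOnes, shift_oneZeros] <;> simp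
  have key : ∀ n u, shift^[n] u = oneZeros → Conn ∅ u zeros := by
    intro n u h
    rcases halt n with e | e
    · exact (conn_of_shift_iterate_eq (h.trans e.2.symm)).trans h2
    · exact (conn_of_shift_iterate_eq (h.trans e.1.symm)).trans h1
  obtain ⟨n, h | h | h | h⟩ := hu
  · exact conn_of_shift_iterate_eq (h.trans (h0 n).symm)
  · exact key (n + 1) u (by rw [Function.iterate_succ_apply', h, shift_zeroOnes])
  · exact key n u h
  · exact key (n + 1) u (by rw [Function.iterate_succ_apply', h, shift_cons])

/-- The generators change only finitely many letters, except for `a(0^ω) = (01)^ω` and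
`b(0^ω) = (10)^ω`. -/
theorem Adj.cofinal_or {u v : InfWord (Fin 2)} (h : Adj u v) :
    (∃ n, shift^[n] u = shift^[n] v) ∨ u ∈ coreTails ∧ v ∈ coreTails := by
  have key : ∀ u : InfWord (Fin 2), u = zeros ∨
      ∃ n, shift^[n] (permA u) = shift^[n] u ∧ shift^[n] (permB u) = shift^[n] u := by
    intro u
    by_cases hu : ∃ i, u i = 1
    · obtain ⟨i, hi⟩ := hu
      refine .inr ⟨i + 1, ?_, ?_⟩ <;> funext k <;> simp only [shift_iterate_apply]
      · exact permA_apply_of_one_lt hi (by omega)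
      · exact permB_apply_of_one_lt hi (by omega)
    · exact .inl (funext fun i => (eq_zero_or_one _).resolve_right fun h => hu ⟨i, h⟩)
  have h0 : zeros ∈ coreTails := ⟨0, .inl rfl⟩
  have h1 : permA zeros ∈ coreTails := ⟨0, .inr (.inl permA_zeros)⟩
  have h2 : permB zeros ∈ coreTails := ⟨0, .inr (.inr (.inl permB_zeros))⟩
  rcases h with rfl | rfl | rfl | rfl
  · rcases key u with rfl | ⟨n, hn⟩
    exacts [.inr ⟨h0, h1⟩, .inl ⟨n, hn.1.symm⟩]
  · rcases key v with rfl | ⟨n, hn⟩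
    exacts [.inr ⟨h1, h0⟩, .inl ⟨n, hn.1⟩]
  · rcases key u with rfl | ⟨n, hn⟩
    exacts [.inr ⟨h0, h2⟩, .inl ⟨n, hn.2.symm⟩]
  · rcases key v with rfl | ⟨n, hn⟩
    exacts [.inr ⟨h2, h0⟩, .inl ⟨n, hn.2⟩]

theorem shift_iterate_eq_of_le {u v : InfWord (Fin 2)} {m n : ℕ}
    (h : shift^[m] u = shift^[m] v) (hmn : m ≤ n) : shift^[n] u = shift^[n] v := by
  obtain ⟨k, rfl⟩ := Nat.exists_eq_add_of_le' hmn
  rw [Function.iterate_add_apply, h, Function.iterate_add_apply]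

/-- Apart from the orbit of `0^ω`, orbits consist of cofinal words. -/
theorem Conn.cofinal_or {u v : InfWord (Fin 2)} (h : Conn ∅ u v) :
    (∃ n, Basilica.shift^[n] u = Basilica.shift^[n] v) ∨ u ∈ coreTails ∧ v ∈ coreTails := by
  induction h with
  | refl => exact .inl ⟨0, rfl⟩
  | tail _ hstep ih =>
    rcases ih with ⟨m, hm⟩ | ⟨hu, hv⟩ <;>
      rcases hstep.1.cofinal_or with ⟨n, hn⟩ | ⟨hv', hw⟩
    · exact .inl ⟨max m n, (shift_iterate_eq_of_le hm (le_max_left m n)).trans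
        (shift_iterate_eq_of_le hn (le_max_right m n))⟩
    · exact .inr ⟨mem_coreTails_congr hm.symm hv', hw⟩
    · exact .inr ⟨hu, mem_coreTails_congr hn hv⟩
    · exact .inr ⟨hu, hw⟩

theorem numEnds_of_mem_coreTails {ξ : InfWord (Fin 2)} (hξ : ξ ∈ coreTails) :
    numEnds (orbitalGraph ξ) = 4 := by
  refine le_antisymm ?_
    (four_le_numEnds (fun _ => rfl) (fun _ => rfl) (conn_zeros_of_mem_coreTails hξ))
  have hmem : ∀ u, Conn ∅ ξ u → u ∈ coreTails := by
    intro u hu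
    rcases hu.cofinal_or with ⟨n, hn⟩ | h
    · exact mem_coreTails_congr hn hξ
    · exact h.2
  refine numEnds_orbitalGraph_le 4 (fun _ => core) (fun _ => by unfold core; exact Set.toFinite _)
    (fun u hu => eventually_shift_iterate_mem_core (hmem u hu))
    ((eventually_shift_iterate_mem_core hξ).mono fun n hn => ?_).frequently
  refine ⟨![permA zeroOnes, permB oneZeros, permA.symm zeros, permB.symm zeros],
    fun s hs hsc => ?_⟩
  obtain ⟨c, hc, x, hx, hxc, hcon⟩ := hs.symm.exists_exit hn hsc
  -- Every edge from `core` to its complement starts one of the four branches.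
  have hA : ∀ {u v w : InfWord (Fin 2)}, permA u = w → permA v = w → u = v := fun h h' =>
    permA.injective (h.trans h'.symm)
  have hB : ∀ {u v w : InfWord (Fin 2)}, permB u = w → permB v = w → u = v := fun h h' =>
    permB.injective (h.trans h'.symm)
  have c0 : zeros ∈ core := .inl rfl
  have c1 : zeroOnes ∈ core := .inr (.inl rfl)
  have c2 : oneZeros ∈ core := .inr (.inr (.inl rfl))
  have c3 : cons 1 oneZeros ∈ core := .inr (.inr (.inr rfl))
  rcases hx with rfl | rfl | rfl | rfl <;> rcases hxc with h | h | h | h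
  · exact absurd (h ▸ permA_zeros ▸ c1) hc
  · exact ⟨2, by rwa [← (Equiv.symm_apply_eq _).2 h.symm] at hcon⟩
  · exact absurd (h ▸ permB_zeros ▸ c2) hc
  · exact ⟨3, by rwa [← (Equiv.symm_apply_eq _).2 h.symm] at hcon⟩
  · exact ⟨0, by rwa [← h] at hcon⟩
  · exact absurd (hA h permA_zeros ▸ c0) hc
  · exact absurd (h ▸ permB_zeroOnes ▸ c3) hc
  · exact absurd (hB h permB_cons_one_oneZeros ▸ c3) hc
  · exact absurd (h ▸ permA_oneZeros.symm ▸ c2) hc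
  · exact absurd (hA h permA_oneZeros ▸ c2) hc
  · exact ⟨1, by rwa [← h] at hcon⟩
  · exact absurd (hB h permB_zeros ▸ c0) hc
  · exact absurd (h ▸ (permA_cons_one _).symm ▸ c3) hc
  · exact absurd (hA h (permA_cons_one _) ▸ c3) hc
  · exact absurd (h ▸ permB_cons_one_oneZeros ▸ c1) hc
  · exact absurd (hB h permB_zeroOnes ▸ c1) hc

/-! ### The remaining orbits -/

/-- If `t` starts with `1`, then `a` fixes `t`, so that `t` can only be left along its
`b`-orbit. -/
theorem exists_conn_permB {t s : InfWord (Fin 2)} (ht : t 0 = 1) (hs : Conn ∅ t s) (hst : s ≠ t) :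
    ∃ c, c ≠ t ∧ (permB t = c ∨ permB c = t) ∧ Conn {t} s c := by
  obtain ⟨c, hc, x, rfl, hxc, hcon⟩ := hs.symm.exists_exit (A := {t}) rfl hst
  refine ⟨c, hc, ?_, hcon⟩
  rcases hxc with h | h | h | h
  · exact absurd (h.symm.trans (permA_of_one ht)) hc
  · exact absurd (permA.injective (h.trans (permA_of_one ht).symm)) hc
  · exact .inl h
  · exact .inr h

theorem exhausts_of_notMem_coreTails {ξ : InfWord (Fin 2)} (hξ : ξ ∉ coreTails)
    {u : InfWord (Fin 2)} (hu : Conn ∅ ξ u) :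
    ∀ᶠ n in Filter.atTop, shift^[n] u ∈ ({shift^[n] ξ} : Set (InfWord (Fin 2))) := by
  obtain ⟨n, hn⟩ := hu.cofinal_or.resolve_right fun h => hξ h.1
  exact Filter.eventually_atTop.2 ⟨n, fun m hm => (shift_iterate_eq_of_le hn hm).symm⟩

theorem numEnds_le_two {ξ : InfWord (Fin 2)} (hξ : ξ ∉ coreTails) :
    numEnds (orbitalGraph ξ) ≤ 2 := by
  refine numEnds_orbitalGraph_le 2 (fun n => {shift^[n] ξ}) (fun _ => Set.finite_singleton _)
    (fun u => exhausts_of_notMem_coreTails hξ) (Filter.frequently_atTop.2 fun N => ?_)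
  obtain ⟨n, hn, h1⟩ : ∃ n ≥ N, ξ n = 1 := by
    by_contra! hcon
    refine hξ ⟨N, .inl (funext fun k => ?_)⟩
    rw [shift_iterate_apply]
    exact (eq_zero_or_one _).resolve_right (hcon _ (by omega))
  have ht : shift^[n] ξ 0 = 1 := by rw [shift_iterate_apply, zero_add, h1]
  refine ⟨n, hn, ![permB (shift^[n] ξ), permB.symm (shift^[n] ξ)], fun s hs hst => ?_⟩
  obtain ⟨c, -, h | h, hcon⟩ := exists_conn_permB ht hs hst
  · exact ⟨0, by rwa [← h] at hcon⟩
  · exact ⟨1, by rwa [← (Equiv.symm_apply_eq _).2 h.symm] at hcon⟩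

/-- If `t` starts with `1` and its `b`-orbit is finite, then removing `t` does not disconnect the
graph. -/
theorem conn_permB_of_odd_one {t s : InfWord (Fin 2)} {i : ℕ} (ht : t 0 = 1) (hi : Odd i)
    (hti : t i = 1) (hs : Conn ∅ t s) (hst : s ≠ t) : Conn {t} s (permB t) := by
  obtain ⟨c, hc, h | h, hcon⟩ := exists_conn_permB ht hs hst
  · rwa [h]
  · refine hcon.trans ?_
    obtain ⟨m, hm, hper⟩ := (exists_iterate_eq_self i t hti).2 hi
    have hp : 0 < Function.minimalPeriod permB t :=
      Function.IsPeriodicPt.minimalPeriod_pos hm hper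
    have hne : ∀ k, k + 1 < Function.minimalPeriod permB t → permB^[k + 1] t ≠ t := fun k hk =>
      Function.not_isPeriodicPt_of_pos_of_lt_minimalPeriod (by omega) hk
    have hpath : ∀ k, k + 1 < Function.minimalPeriod permB t →
        Conn {t} (permB t) (permB^[k + 1] t) := by
      intro k
      induction k with
      | zero => exact fun _ => .refl _
      | succ k ih =>
        intro hk
        refine (ih (by omega)).trans (.of_adj (.inr (.inr (.inl ?_))) (hne k (by omega)) (hne _ hk))
        exact (Function.iterate_succ_apply' permB (k + 1) t).symm
    -- The word `c = b⁻¹(t)` is the last one of the cycle which starts in `b(t)`.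
    obtain ⟨k, hk⟩ := Nat.exists_eq_add_of_lt hp
    rw [zero_add] at hk
    have hlast : permB^[k] t = c := by
      have hend := Function.iterate_minimalPeriod (f := permB) (x := t)
      rw [hk, Function.iterate_succ_apply'] at hend
      exact permB.injective (hend.trans h.symm)
    cases k with
    | zero => exact absurd hlast.symm hc
    | succ k =>
      rw [← hlast]
      exact (hpath k (by omega)).symm

theorem exists_ge_of_infinite {p : ℕ → Prop} (h : {i | p i}.Infinite) (N : ℕ) : ∃ i ≥ N, p i := by
  obtain ⟨i, hi, hN⟩ := h.exists_gt N
  exact ⟨i, hN.le, hi⟩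

theorem notMem_coreTails_of_infinite {ξ : InfWord (Fin 2)} (h₀ : {i : ℕ | ξ (2 * i) = 1}.Infinite)
    (h₁ : {i : ℕ | ξ (2 * i + 1) = 1}.Infinite) : ξ ∉ coreTails := by
  intro hξ
  have key : ∀ N, ¬ ∀ k, ξ (2 * k + N) = 0 := by
    intro N hN
    obtain ⟨M, rfl | rfl⟩ := Nat.even_or_odd' N
    · obtain ⟨i, hi, h⟩ := exists_ge_of_infinite h₀ M
      have := hN (i - M)
      rw [show 2 * (i - M) + 2 * M = 2 * i by omega, h] at this
      simp at this
    · obtain ⟨i, hi, h⟩ := exists_ge_of_infinite h₁ M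
      have := hN (i - M)
      rw [show 2 * (i - M) + (2 * M + 1) = 2 * i + 1 by omega, h] at this
      simp at this
  have keyZ : ∀ N, shift^[N] ξ ≠ zeroOnes := fun N h => key N fun k => by
    rw [← shift_iterate_apply ξ N, h]
    simp [zeroOnes]
  obtain ⟨N, h | h | h | h⟩ := hξ
  · exact key N fun k => by
      rw [← shift_iterate_apply ξ N, h]
      rfl
  · exact keyZ N h
  · exact keyZ (N + 1) (by rw [Function.iterate_succ_apply', h, shift_oneZeros])
  · exact keyZ (N + 2) (by
      rw [Function.iterate_succ_apply', Function.iterate_succ_apply', h, shift_cons,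
        shift_oneZeros])

theorem numEnds_of_infinite {ξ : InfWord (Fin 2)} (h₀ : {i : ℕ | ξ (2 * i) = 1}.Infinite)
    (h₁ : {i : ℕ | ξ (2 * i + 1) = 1}.Infinite) : numEnds (orbitalGraph ξ) = 1 := by
  have hξ := notMem_coreTails_of_infinite h₀ h₁
  refine le_antisymm ?_ (one_le_numEnds ξ)
  refine numEnds_orbitalGraph_le 1 (fun n => {shift^[n] ξ}) (fun _ => Set.finite_singleton _)
    (fun u => exhausts_of_notMem_coreTails hξ) (Filter.frequently_atTop.2 fun N => ?_)
  obtain ⟨n, hn, h⟩ := exists_ge_of_infinite h₀ N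
  obtain ⟨m, hm, h'⟩ := exists_ge_of_infinite h₁ n
  refine ⟨2 * n, by omega, fun _ => permB (shift^[2 * n] ξ), fun s hs hst => ⟨0, ?_⟩⟩
  refine conn_permB_of_odd_one (i := 2 * (m - n) + 1) ?_ ⟨_, rfl⟩ ?_ hs hst
  · rw [shift_iterate_apply, zero_add, h]
  · rw [shift_iterate_apply, show 2 * (m - n) + 1 + 2 * n = 2 * m + 1 by omega, h']

/-- If the letters of `ξ` at the even or at the odd positions are eventually `0`, then the orbit of
`ξ` contains an infinite orbit of a generator. -/
theorem numEnds_of_finite {ξ : InfWord (Fin 2)} (hξ : ξ ∉ coreTails)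
    (h : ¬ ({i : ℕ | ξ (2 * i) = 1}.Infinite ∧ {i : ℕ | ξ (2 * i + 1) = 1}.Infinite)) :
    numEnds (orbitalGraph ξ) = 2 := by
  refine le_antisymm (numEnds_le_two hξ) ?_
  have hconn : ∀ N, Conn ∅ ξ (fun k => if k < N then 0 else ξ k) := by
    refine fun N => conn_of_shift_iterate_eq (n := N) (funext fun k => ?_)
    rw [shift_iterate_apply, shift_iterate_apply, if_neg (by omega)]
  have hbound : ∀ p : ℕ → ℕ, ¬ {i : ℕ | ξ (p i) = 1}.Infinite → ∃ N, ∀ i ≥ N, ξ (p i) = 0 := by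
    intro p hp
    obtain ⟨N, hN⟩ := (Set.not_infinite.1 hp).bddAbove
    refine ⟨N + 1, fun i hi => (eq_zero_or_one _).resolve_right fun h1 => ?_⟩
    have : i ≤ N := hN h1
    omega
  rcases not_and_or.1 h with h | h
  · obtain ⟨N, hN⟩ := hbound _ h
    refine isPotential_potA.two_le_numEnds (fun j => ?_) (hconn (2 * N))
    split_ifs with hj
    · rfl
    · exact hN j (by omega)
  · obtain ⟨N, hN⟩ := hbound _ h
    refine isPotential_potB.two_le_numEnds (fun j => ?_) (hconn (2 * N))
    split_ifs with hj
    · rfl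
    · exact hN j (by omega)

/-! ### The classification -/

theorem exists_eq_append_iff {ξ u : InfWord (Fin 2)} :
    (∃ w : List (Fin 2), ξ = append w u) ↔ ∃ n, shift^[n] ξ = u := by
  constructor
  · rintro ⟨w, rfl⟩
    refine ⟨w.length, funext fun k => ?_⟩
    simp [shift_iterate_apply, append]
  · rintro ⟨n, rfl⟩
    refine ⟨List.ofFn fun i : Fin n => ξ i, funext fun k => ?_⟩
    by_cases hk : k < n
    · simp [append, hk]
    · simp [append, hk, shift_iterate_apply, Nat.sub_add_cancel (not_lt.1 hk)]

theorem mem_coreTails_iff {ξ : InfWord (Fin 2)} :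
    ξ ∈ coreTails ↔ ∃ w : List (Fin 2), ξ = append w zeros ∨ ξ = append w zeroOnes := by
  rw [exists_or, exists_eq_append_iff, exists_eq_append_iff]
  constructor
  · rintro ⟨n, h | h | h | h⟩
    · exact .inl ⟨n, h⟩
    · exact .inr ⟨n, h⟩
    · exact .inr ⟨n + 1, by rw [Function.iterate_succ_apply', h, shift_oneZeros]⟩
    · exact .inr ⟨n + 2, by
        rw [Function.iterate_succ_apply', Function.iterate_succ_apply', h, shift_cons,
          shift_oneZeros]⟩
  · rintro (⟨n, h⟩ | ⟨n, h⟩)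
    · exact ⟨n, .inl h⟩
    · exact ⟨n, .inr (.inl h)⟩

end Basilica

theorem mainTheorem1 :
    Basilica.E 4 = {ξ | ∃ w : List (Fin 2),
      ξ = Basilica.append w Basilica.zeros ∨ ξ = Basilica.append w Basilica.zeroOnes} ∧
    Basilica.E 1 =
      {ξ | {i : ℕ | ξ (2 * i) = 1}.Infinite ∧ {i : ℕ | ξ (2 * i + 1) = 1}.Infinite} ∧
    Basilica.E 2 = (Basilica.E 1 ∪ Basilica.E 4)ᶜ := by
  have h4 : ∀ ξ, ξ ∈ Basilica.coreTails → Basilica.numEnds (Basilica.orbitalGraph ξ) = 4 :=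
    fun ξ h => Basilica.numEnds_of_mem_coreTails h
  have h1 : ∀ ξ : Basilica.InfWord (Fin 2), {i : ℕ | ξ (2 * i) = 1}.Infinite ∧
      {i : ℕ | ξ (2 * i + 1) = 1}.Infinite → Basilica.numEnds (Basilica.orbitalGraph ξ) = 1 :=
    fun ξ h => Basilica.numEnds_of_infinite h.1 h.2
  have h2 : ∀ ξ : Basilica.InfWord (Fin 2), ξ ∉ Basilica.coreTails →
      ¬ ({i : ℕ | ξ (2 * i) = 1}.Infinite ∧ {i : ℕ | ξ (2 * i + 1) = 1}.Infinite) →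
      Basilica.numEnds (Basilica.orbitalGraph ξ) = 2 :=
    fun ξ h h' => Basilica.numEnds_of_finite h h'
  have n12 : (1 : ℕ∞) ≠ 2 := by norm_num
  have n14 : (1 : ℕ∞) ≠ 4 := by norm_num
  have n24 : (2 : ℕ∞) ≠ 4 := by norm_num
  refine ⟨?_, ?_, ?_⟩ <;> ext ξ
  · rw [Set.mem_ofPred_eq, ← Basilica.mem_coreTails_iff]
    change Basilica.numEnds _ = 4 ↔ _
    grind
  · rw [Set.mem_ofPred_eq]
    change Basilica.numEnds _ = 1 ↔ _
    grind
  · change Basilica.numEnds _ = 2 ↔ ¬ (Basilica.numEnds _ = 1 ∨ Basilica.numEnds _ = 4)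
    grind
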